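/- Let $d\ge 0$ and $n\ge 1$ be integers, $\boldsymbol z\in\mathbb Z^d$, and let $r\colon\mathbb Z^d\to(0,\infty)$ be a weight function. Let $\mathcal B\subseteq\mathbb Z^d$ be a nonempty frequency set for which the rank-1 lattice $\boldsymbol X=\{\frac kn\boldsymbol z\bmod 1\}_{k=0}^{n-1}$ has the reconstructing property, i.e. $\langle\boldsymbol h,\boldsymbol z\rangle\not\equiv\langle\boldsymbol h',\boldsymbol z\rangle\pmod n$ for all distinct $\boldsymbol h,\boldsymbol h'\in\mathcal B$ (in particular $\mathcal B$ is finite). For a finite multiset $J$ of elements of $\{0,\dots,n-1\}$, whose cardinality $|J|$ counts repetitions, put $$\boldsymbol L_{J,\mathcal B}=\Big[\exp\big(2\pi\mathrm i\tfrac kn\langle\boldsymbol h,\boldsymbol z\rangle\big)\Big]_{k\in J,\,\boldsymbol h\in\mathcal B},\qquad \boldsymbol\Phi_{J,\mathcal B}=\Big[\frac{\exp(2\pi\mathrm i\frac kn\langle\boldsymbol h,\boldsymbol z\rangle)}{\sqrt{r(\boldsymbol h)}}\Big]_{k\in J,\,\boldsymbol h\in\mathbb Z^d\setminus\mathcal B},\qquad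 \boldsymbol\Phi_{\mathcal B}=\boldsymbol\Phi_{\{0,\dots,n-1\},\mathcal B}.$$ Let $\sigma_{\min}(\boldsymbol L_{J,\mathcal B})$ and $\sigma_{\max}(\boldsymbol L_{J,\mathcal B})$ denote the smallest and the largest of the $|\mathcal B|$ singular values of $\boldsymbol L_{J,\mathcal B}$, and let $\|\cdot\|_2\in[0,\infty]$ denote the spectral norm of a matrix (operator norm between the $\ell^2$ spaces). Let $t>0$ and let $J$ consist of $|J|$ integers drawn independently and uniformly at random from $\{0,\dots,n-1\}$, where the fixed number $|J|$ satisfies $$|J|\ge 12\,|\mathcal B|\,(\log|\mathcal B|+t).$$ Then each of the two inequalities $$\frac{|J|}{2}\le\sigma_{\min}^2(\boldsymbol L_{J,\mathcal B})\qquad\text{and}\qquad\sigma_{\max}^2(\boldsymbol L_{J,\mathcal B})\le\frac{3|J|}{2}$$ holds with probability exceeding $1-\exp(-t)$. If moreover $|J|\ge 3$, then with probability exceeding $1-2^{3/4}\exp(-t)$ $$\|\boldsymbol\Phi_{J,\mathcal B}\|_2^2\le 21\,(\log|J|+t)\sum_{\boldsymbol h\in\mathbb Z^d\setminus\mathcal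 B}\frac1{r(\boldsymbol h)}+2\,\frac{|J|}{n}\,\|\boldsymbol\Phi_{\mathcal B}\|_2^2,$$ where the right-hand side is understood as $\infty$ if the sum diverges. -/

import Mathlib

open MeasureTheory ProbabilityTheory
open scoped ENNReal

namespace RankOneLattice

/-- The rank-1 lattice `{(k / n) z mod 1 : 0 ≤ k < n}` has the reconstructing property on `B`:
distinct frequencies of `B` have incongruent inner products with `z` modulo `n`. -/
def Reconstructing {d : ℕ} (n : ℕ) (z : Fin d → ℤ) (B : Finset (Fin d → ℤ)) : Prop :=
  ∀ h ∈ B, ∀ h' ∈ B, h ≠ h' → ¬ h ⬝ᵥ z ≡ h' ⬝ᵥ z [ZMOD (n : ℤ)]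

/-- `exp(2πi (k / n) ⟨h, z⟩)`: the value of the `h`-th exponential at the `k`-th lattice point. -/
noncomputable def latticeExp {d n : ℕ} (z : Fin d → ℤ) (k : Fin n) (h : Fin d → ℤ) : ℂ :=
  Complex.exp (2 * Real.pi * Complex.I * ((k : ℕ) / n : ℂ) * ((h ⬝ᵥ z : ℤ) : ℂ))

/-- The matrix `L_{J,B}`. The multiset `J ⊆ {0, …, n-1}` is given by a family `k : κ → Fin n`
listing its elements with repetition. -/
noncomputable def matrixL {d n : ℕ} {κ : Type*} (z : Fin d → ℤ) (B : Finset (Fin d → ℤ))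
    (k : κ → Fin n) : Matrix κ B ℂ :=
  Matrix.of fun j h => latticeExp z (k j) h

/-- The matrix `Φ_{J,B}`, whose columns are indexed by all frequencies outside `B`. -/
noncomputable def matrixPhi {d n : ℕ} {κ : Type*} (r : (Fin d → ℤ) → ℝ) (z : Fin d → ℤ)
    (B : Finset (Fin d → ℤ)) (k : κ → Fin n) : Matrix κ {h : Fin d → ℤ // h ∉ B} ℂ :=
  Matrix.of fun j h => latticeExp z (k j) h / (√(r h) : ℂ)

/-- The largest singular value (Mathlib's singular values are listed in decreasing order,
starting from index `0`). -/
noncomputable def sigmaMax {κ ι : Type*} [Fintype κ] [Fintype ι] [DecidableEq ι]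
    (A : Matrix κ ι ℂ) : ℝ :=
  (Matrix.toEuclideanLin A).singularValues 0

/-- The smallest of the `|ι|` singular values of a matrix with columns indexed by `ι`, i.e. the
square root of the smallest eigenvalue of `Aᴴ A`. -/
noncomputable def sigmaMin {κ ι : Type*} [Fintype κ] [Fintype ι] [DecidableEq ι]
    (A : Matrix κ ι ℂ) : ℝ :=
  (Matrix.toEuclideanLin A).singularValues (Fintype.card ι - 1)

/-- The spectral norm of a matrix with finitely many rows and possibly infinitely many columns,
i.e. its operator norm from `ℓ²(ι)` to `ℓ²(κ)`. It is the supremum of `‖A x‖₂` over the finitely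
supported `x` with `‖x‖₂ ≤ 1`; these are dense in the unit ball of `ℓ²(ι)`. The value is `∞`
exactly if `A` does not define a bounded operator. -/
noncomputable def specNorm {κ ι : Type*} [Fintype κ] (A : Matrix κ ι ℂ) : ℝ≥0∞ :=
  ⨆ (x : ι →₀ ℂ) (_ : ∑ i ∈ x.support, ‖x i‖ ^ 2 ≤ 1),
    ‖(WithLp.toLp 2 fun j => ∑ i ∈ x.support, A j i * x i : EuclideanSpace ℂ κ)‖ₑ

end RankOneLattice

/-!
The proof is the method of matrix exponential moments, run on the finite space of index maps
`f : Fin m → Fin n`, under which the sample is uniform; probabilities become counts of bad maps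
(`one_sub_lt_measureReal_of_card`).

Both matrices `A = L_{J,B}` and `A = Φ_{J,B}` (the latter cut down to finitely many columns) satisfy
`Aᴴ A = ∑ⱼ v_{f j} v_{f j}*`, where all vectors `v_k` have the same squared length `c`, so that
`exp (s v_k v_k*) = 1 + ((e^{sc} - 1) / c) v_k v_k*`. The Golden–Thompson inequality
`trace_exp_add_le` allows to average over one sample at a time (`sum_trace_exp_succ_le`).

* For `L`, the reconstructing property gives `∑ₖ v_k v_k* = n • 1`. The recursion for the trace of the
  exponential then closes exactly, and `card_not_le_of_isotropic` bounds the number of bad maps by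
  `|B| e^{-b} (1 + (e^{sc} - 1) / c)^m n^m`. With `c = |B|`, the choices `e^{sc} = 1/2` and
  `e^{sc} = 3/2` give both singular value estimates: the constant `12` suffices because
  `12 (1 - log 2) / 2 > 1` and `12 (3 log (3/2) - 1) / 2 > 1`.
* For `Φ`, the number of columns is unbounded, so the trace of `exp - 1` is used instead. It satisfies
  a recursion with source term `∑ₖ ‖v_k‖² = n c`, and `card_not_le_of_bounded` has the number `m` of
  samples in place of the dimension. Since there are finitely many maps, finitely many columns witness
  every violation of the bound on the spectral norm, and no limit is needed.

The Golden–Thompson inequality is derived from the Lie–Trotter formula `tendsto_exp_mul_exp_pow` and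
the trace inequality `|tr (A B)^N| ≤ |tr A^N B^N|` for Hermitian `A`, `B` and `N` a power of two.
-/

namespace RankOneLattice

open Matrix Filter Topology
open scoped ComplexOrder

/-! ### The Lie–Trotter product formula -/

theorem norm_exp_le_exp_norm {𝔸 : Type*} [NormedRing 𝔸] [NormedAlgebra ℝ 𝔸] [CompleteSpace 𝔸]
    [NormOneClass 𝔸] (x : 𝔸) : ‖NormedSpace.exp x‖ ≤ Real.exp ‖x‖ := by
  have h1 := NormedSpace.exp_series_hasSum_exp' (𝕂 := ℝ) x
  have h2 := NormedSpace.exp_series_hasSum_exp' (𝕂 := ℝ) ‖x‖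
  rw [← Real.exp_eq_exp_ℝ] at h2
  rw [← h1.tsum_eq]
  refine tsum_of_norm_bounded h2 fun k => ?_
  rw [norm_smul, smul_eq_mul, Real.norm_of_nonneg (by positivity)]
  gcongr
  exact norm_pow_le x k

theorem norm_pow_sub_pow_le {𝔸 : Type*} [NormedRing 𝔸] [NormOneClass 𝔸] {x y : 𝔸} {K : ℝ}
    (hK : 1 ≤ K) (hx : ‖x‖ ≤ K) (hy : ‖y‖ ≤ K) (N : ℕ) :
    ‖x ^ N - y ^ N‖ ≤ N * K ^ N * ‖x - y‖ := by
  induction N with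
  | zero => simp
  | succ N ih =>
    have h : x ^ (N + 1) - y ^ (N + 1) = x * (x ^ N - y ^ N) + (x - y) * y ^ N := by
      rw [pow_succ', pow_succ']; noncomm_ring
    have hyN : ‖y ^ N‖ ≤ K ^ (N + 1) :=
      (norm_pow_le y N).trans <| (pow_le_pow_left₀ (norm_nonneg _) hy N).trans <|
        pow_le_pow_right₀ hK N.le_succ
    calc ‖x ^ (N + 1) - y ^ (N + 1)‖
        ≤ ‖x‖ * ‖x ^ N - y ^ N‖ + ‖x - y‖ * ‖y ^ N‖ := by
          rw [h]
          exact (norm_add_le _ _).trans (add_le_add (norm_mul_le _ _) (norm_mul_le _ _))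
      _ ≤ K * (N * K ^ N * ‖x - y‖) + ‖x - y‖ * K ^ (N + 1) := by gcongr
      _ = (N + 1 : ℕ) * K ^ (N + 1) * ‖x - y‖ := by push_cast; ring

/-- The Lie–Trotter product formula. -/
theorem tendsto_exp_mul_exp_pow {𝔸 : Type*} [NormedRing 𝔸] [NormedAlgebra ℝ 𝔸] [CompleteSpace 𝔸]
    [NormOneClass 𝔸] (a b : 𝔸) :
    Tendsto (fun N : ℕ => (NormedSpace.exp ((N : ℝ)⁻¹ • a) * NormedSpace.exp ((N : ℝ)⁻¹ • b)) ^ N)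
      atTop (𝓝 (NormedSpace.exp (a + b))) := by
  let _ : NormedAlgebra ℚ 𝔸 := NormedAlgebra.restrictScalars ℚ ℝ 𝔸
  -- The two sides agree to first order in the step size.
  have hderiv : HasDerivAt (fun s : ℝ => NormedSpace.exp (s • a) * NormedSpace.exp (s • b) -
      NormedSpace.exp (s • (a + b))) 0 0 := by
    have ha := hasDerivAt_exp_smul_const (𝕂 := ℝ) a (0 : ℝ)
    have hb := hasDerivAt_exp_smul_const (𝕂 := ℝ) b (0 : ℝ)
    have hab := hasDerivAt_exp_smul_const (𝕂 := ℝ) (a + b) (0 : ℝ)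
    convert! (ha.mul hb).sub hab using 1
    simp
  have hslope := hasDerivAt_iff_tendsto_slope_zero.1 hderiv
  have hinv : Tendsto (fun N : ℕ => (N : ℝ)⁻¹) atTop (𝓝[≠] 0) := by
    refine tendsto_nhdsWithin_iff.2 ⟨tendsto_inv_atTop_nhds_zero_nat, ?_⟩
    filter_upwards [eventually_gt_atTop 0] with N hN
    simpa using hN.ne'
  have hlim := (hslope.comp hinv).norm.const_mul (Real.exp (‖a‖ + ‖b‖))
  rw [norm_zero, mul_zero] at hlim
  rw [tendsto_iff_norm_sub_tendsto_zero]
  refine squeeze_zero' (Eventually.of_forall fun _ => norm_nonneg _) ?_ hlim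
  filter_upwards [eventually_gt_atTop 0] with N hN
  have hN' : (N : ℝ) ≠ 0 := by exact_mod_cast hN.ne'
  have hnn : (0 : ℝ) ≤ (N : ℝ)⁻¹ := by positivity
  have hpow : NormedSpace.exp (a + b) = NormedSpace.exp ((N : ℝ)⁻¹ • (a + b)) ^ N := by
    rw [← NormedSpace.exp_nsmul, ← Nat.cast_smul_eq_nsmul ℝ, smul_smul, mul_inv_cancel₀ hN',
      one_smul]
  set K := Real.exp ((N : ℝ)⁻¹ * (‖a‖ + ‖b‖)) with hK
  have hx : ‖NormedSpace.exp ((N : ℝ)⁻¹ • a) * NormedSpace.exp ((N : ℝ)⁻¹ • b)‖ ≤ K := by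
    refine (norm_mul_le _ _).trans ((mul_le_mul (norm_exp_le_exp_norm _) (norm_exp_le_exp_norm _)
      (norm_nonneg _) (Real.exp_nonneg _)).trans_eq ?_)
    rw [← Real.exp_add, norm_smul, norm_smul, Real.norm_of_nonneg hnn, hK, mul_add]
  have hy : ‖NormedSpace.exp ((N : ℝ)⁻¹ • (a + b))‖ ≤ K := by
    refine (norm_exp_le_exp_norm _).trans (Real.exp_le_exp.2 ?_)
    rw [norm_smul, Real.norm_of_nonneg hnn]
    gcongr
    exact norm_add_le _ _
  have hKN : K ^ N = Real.exp (‖a‖ + ‖b‖) := by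
    rw [hK, ← Real.exp_nat_mul, ← mul_assoc, mul_inv_cancel₀ hN', one_mul]
  rw [hpow]
  refine (norm_pow_sub_pow_le (Real.one_le_exp (by positivity)) hx hy N).trans_eq ?_
  rw [hKN]
  simp [norm_smul]
  ring

/-! ### The Golden–Thompson inequality -/

section GoldenThompson

variable {ι : Type*} [Fintype ι]

/-- Cauchy–Schwarz for the Frobenius inner product, in additive form. In the proof of the trace
inequality below the two summands agree, so nothing is lost. -/
theorem norm_trace_mul_le (A B : Matrix ι ι ℂ) :
    ‖(A * B).trace‖ ≤ ((Aᴴ * A).trace.re + (Bᴴ * B).trace.re) / 2 := by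
  have hfrob : ∀ M : Matrix ι ι ℂ, (Mᴴ * M).trace.re = ∑ i, ∑ j, ‖M j i‖ ^ 2 := by
    intro M
    simp [Matrix.trace, Matrix.mul_apply, Complex.re_sum, ← Complex.normSq_eq_norm_sq,
      Complex.normSq_apply]
  rw [hfrob, hfrob, Finset.sum_comm (f := fun i j => ‖A j i‖ ^ 2), ← Finset.sum_add_distrib,
    Finset.sum_div]
  refine (norm_sum_le _ _).trans (Finset.sum_le_sum fun i _ => ?_)
  rw [Matrix.diag_apply, Matrix.mul_apply, ← Finset.sum_add_distrib, Finset.sum_div]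
  refine (norm_sum_le _ _).trans (Finset.sum_le_sum fun j _ => ?_)
  rw [norm_mul]
  nlinarith [sq_nonneg (‖A i j‖ - ‖B j i‖)]

variable [DecidableEq ι]

theorem trace_mul_pow_comm (X Y : Matrix ι ι ℂ) (q : ℕ) :
    ((X * Y) ^ q).trace = ((Y * X) ^ q).trace := by
  cases q with
  | zero => simp
  | succ q =>
    have h : SemiconjBy X ((Y * X) ^ q) ((X * Y) ^ q) := SemiconjBy.pow_right (by
      simp [SemiconjBy, mul_assoc]) q
    rw [pow_succ, ← mul_assoc, ← h.eq, mul_assoc, trace_mul_comm, mul_assoc, pow_succ]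

/-- Powers of two are what makes the induction close: the bound for squares of a single matrix and
the bound for products of two Hermitian matrices feed each other. -/
theorem norm_trace_pow_two_pow_le (k : ℕ) :
    (∀ M : Matrix ι ι ℂ, ‖(M ^ 2 ^ (k + 1)).trace‖ ≤ ((Mᴴ * M) ^ 2 ^ k).trace.re) ∧
      ∀ A B : Matrix ι ι ℂ, A.IsHermitian → B.IsHermitian →
        ‖((A * B) ^ 2 ^ k).trace‖ ≤ ‖(A ^ 2 ^ k * B ^ 2 ^ k).trace‖ := by
  induction k with
  | zero =>
    refine ⟨fun M => ?_, fun A B _ _ => by simp⟩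
    have := norm_trace_mul_le M M
    simpa [pow_two] using this
  | succ k ih =>
    obtain ⟨ih1, ih2⟩ := ih
    refine ⟨fun M => ?_, fun A B hA hB => ?_⟩
    · have hP : (Mᴴ * M).IsHermitian := isHermitian_conjTranspose_mul_self M
      have hQ : (M * Mᴴ).IsHermitian := isHermitian_mul_conjTranspose_self M
      calc ‖(M ^ 2 ^ (k + 1 + 1)).trace‖ = ‖((M ^ 2) ^ 2 ^ (k + 1)).trace‖ := by
            rw [← pow_mul, ← pow_succ']
        _ ≤ (((M ^ 2)ᴴ * M ^ 2) ^ 2 ^ k).trace.re := ih1 _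
        _ = (((Mᴴ * M) * (M * Mᴴ)) ^ 2 ^ k).trace.re := by
            rw [← mul_assoc (Mᴴ * M) M Mᴴ, trace_mul_pow_comm _ Mᴴ, conjTranspose_pow]
            simp only [pow_two, mul_assoc]
        _ ≤ ‖(((Mᴴ * M) * (M * Mᴴ)) ^ 2 ^ k).trace‖ := Complex.re_le_norm _
        _ ≤ ‖((Mᴴ * M) ^ 2 ^ k * (M * Mᴴ) ^ 2 ^ k).trace‖ := ih2 _ _ hP hQ
        _ ≤ _ := norm_trace_mul_le _ _
        _ = ((Mᴴ * M) ^ 2 ^ (k + 1)).trace.re := by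
            rw [conjTranspose_pow, conjTranspose_pow, hP.eq, hQ.eq, ← pow_add, ← pow_add, ← two_mul,
              ← pow_succ', trace_mul_pow_comm M Mᴴ]
            ring
    · calc ‖((A * B) ^ 2 ^ (k + 1)).trace‖ ≤ (((A * B)ᴴ * (A * B)) ^ 2 ^ k).trace.re := ih1 _
        _ = (((A ^ 2) * (B ^ 2)) ^ 2 ^ k).trace.re := by
            rw [conjTranspose_mul, hA.eq, hB.eq, mul_assoc, trace_mul_pow_comm B, pow_two, pow_two]
            simp only [mul_assoc]
        _ ≤ ‖(((A ^ 2) * (B ^ 2)) ^ 2 ^ k).trace‖ := Complex.re_le_norm _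
        _ ≤ _ := ih2 _ _ (hA.pow 2) (hB.pow 2)
        _ = ‖(A ^ 2 ^ (k + 1) * B ^ 2 ^ (k + 1)).trace‖ := by
            rw [← pow_mul, ← pow_mul, ← pow_succ']

theorem tendsto_matrix_exp_mul_exp_pow [Nonempty ι] (A B : Matrix ι ι ℂ) :
    Tendsto (fun N : ℕ => (NormedSpace.exp ((N : ℝ)⁻¹ • A) * NormedSpace.exp ((N : ℝ)⁻¹ • B)) ^ N)
      atTop (𝓝 (NormedSpace.exp (A + B))) := by
  -- Any normed algebra structure on matrices that induces their topology would do; the instances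
  -- that depend on it agree only up to unfolding.
  open scoped Matrix.Norms.Operator in
  convert! tendsto_exp_mul_exp_pow A B

/-- The Golden–Thompson inequality. -/
theorem trace_exp_add_le {A B : Matrix ι ι ℂ} (hA : A.IsHermitian) (hB : B.IsHermitian) :
    (NormedSpace.exp (A + B)).trace.re ≤
      (NormedSpace.exp A * NormedSpace.exp B).trace.re := by
  cases isEmpty_or_nonempty ι
  · simp [Matrix.trace]
  have hherm : ∀ {C : Matrix ι ι ℂ} (s : ℝ), C.IsHermitian → (s • C).IsHermitian :=
    fun s hC => hC.smul (IsSelfAdjoint.all s)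
  have hbound : ∀ k : ℕ, ‖((NormedSpace.exp (((2 ^ k : ℕ) : ℝ)⁻¹ • A) *
      NormedSpace.exp (((2 ^ k : ℕ) : ℝ)⁻¹ • B)) ^ 2 ^ k).trace‖ ≤
      ‖(NormedSpace.exp A * NormedSpace.exp B).trace‖ := by
    intro k
    have hpow : ∀ C : Matrix ι ι ℂ,
        NormedSpace.exp (((2 ^ k : ℕ) : ℝ)⁻¹ • C) ^ 2 ^ k = NormedSpace.exp C := by
      intro C
      rw [← Matrix.exp_nsmul, ← Nat.cast_smul_eq_nsmul ℝ, smul_smul, mul_inv_cancel₀ (by simp),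
        one_smul]
    refine ((norm_trace_pow_two_pow_le k).2 _ _ (hherm _ hA).exp (hherm _ hB).exp).trans_eq ?_
    rw [hpow, hpow]
  have hlim := (((continuous_id.matrix_trace).tendsto _).comp
    ((tendsto_matrix_exp_mul_exp_pow A B).comp (tendsto_pow_atTop_atTop_of_one_lt
      (r := 2) one_lt_two))).norm
  have hle : ‖(NormedSpace.exp (A + B)).trace‖ ≤ ‖(NormedSpace.exp A * NormedSpace.exp B).trace‖ :=
    le_of_tendsto' hlim hbound
  refine (Complex.re_le_norm _).trans (hle.trans_eq ?_)
  -- The trace on the right is that of a Gram matrix, hence a nonnegative real number.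
  have hhalf : ∀ {C : Matrix ι ι ℂ}, C.IsHermitian → NormedSpace.exp C =
      NormedSpace.exp ((1 / 2 : ℝ) • C) * (NormedSpace.exp ((1 / 2 : ℝ) • C))ᴴ := by
    intro C hC
    rw [(hherm _ hC).exp.eq, ← Matrix.exp_add_of_commute _ _ (Commute.refl _), ← add_smul]
    norm_num
  have hnn := (posSemidef_conjTranspose_mul_self ((NormedSpace.exp ((1 / 2 : ℝ) • B))ᴴ *
    NormedSpace.exp ((1 / 2 : ℝ) • A))).trace_nonneg
  have heq : (NormedSpace.exp A * NormedSpace.exp B).trace = (((NormedSpace.exp ((1 / 2 : ℝ) • B))ᴴ *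
      NormedSpace.exp ((1 / 2 : ℝ) • A))ᴴ * ((NormedSpace.exp ((1 / 2 : ℝ) • B))ᴴ *
      NormedSpace.exp ((1 / 2 : ℝ) • A))).trace := by
    rw [hhalf hA, hhalf hB, conjTranspose_mul, conjTranspose_conjTranspose, (hherm _ hA).exp.eq,
      (hherm _ hB).exp.eq, mul_assoc, trace_mul_comm]
    simp only [mul_assoc]
  rw [heq]
  exact (Complex.re_eq_norm.2 hnn).symm

end GoldenThompson

/-! ### Functions of Hermitian matrices -/

section Spectral

variable {ι : Type*} [Fintype ι] [DecidableEq ι]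

theorem exp_unitary_conj (U : unitaryGroup ι ℂ) (D : Matrix ι ι ℂ) :
    NormedSpace.exp ((U : Matrix ι ι ℂ) * D * star (U : Matrix ι ι ℂ)) =
      U * NormedSpace.exp D * star (U : Matrix ι ι ℂ) :=
  Matrix.exp_units_conj (Unitary.toUnits U) D

theorem exists_unitary_diagonal {A : Matrix ι ι ℂ} (hA : A.IsHermitian) :
    ∃ (U : unitaryGroup ι ℂ) (w : ι → ℝ),
      A = U * diagonal (fun i => (w i : ℂ)) * star (U : Matrix ι ι ℂ) := by
  refine ⟨hA.eigenvectorUnitary, hA.eigenvalues, ?_⟩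
  conv_lhs => rw [hA.spectral_theorem, Unitary.conjStarAlgAut_apply]
  rfl

theorem posSemidef_unitary_conj_diagonal_iff (U : unitaryGroup ι ℂ) (w : ι → ℝ) :
    ((U : Matrix ι ι ℂ) * diagonal (fun i => (w i : ℂ)) * star (U : Matrix ι ι ℂ)).PosSemidef ↔
      ∀ i, 0 ≤ w i := by
  rw [IsUnit.posSemidef_star_right_conjugate_iff (U := (U : Matrix ι ι ℂ))
    ⟨Unitary.toUnits U, rfl⟩, posSemidef_diagonal_iff]
  simp

theorem exp_unitary_conj_diagonal (U : unitaryGroup ι ℂ) (w : ι → ℝ) :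
    NormedSpace.exp ((U : Matrix ι ι ℂ) * diagonal (fun i => (w i : ℂ)) * star (U : Matrix ι ι ℂ)) =
      U * diagonal (fun i => (Real.exp (w i) : ℂ)) * star (U : Matrix ι ι ℂ) := by
  rw [exp_unitary_conj, Matrix.exp_diagonal]
  congr 3
  funext i
  rw [Pi.coe_exp, ← Complex.exp_eq_exp_ℂ, Complex.ofReal_exp]

theorem trace_unitary_conj_diagonal (U : unitaryGroup ι ℂ) (w : ι → ℝ) :
    ((U : Matrix ι ι ℂ) * diagonal (fun i => (w i : ℂ)) * star (U : Matrix ι ι ℂ)).trace.re =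
      ∑ i, w i := by
  rw [mul_assoc, trace_mul_comm, mul_assoc, Unitary.coe_star_mul_self, mul_one, trace_diagonal,
    ← Complex.ofReal_sum, Complex.ofReal_re]

/-- Shifting by a multiple of the identity commutes with diagonalization, so that semidefiniteness
of `b • 1 - A` can be read off the eigenvalues of `A`. -/
theorem smul_one_sub_unitary_conj_diagonal (U : unitaryGroup ι ℂ) (w : ι → ℝ) (b : ℝ) :
    b • (1 : Matrix ι ι ℂ) -
        (U : Matrix ι ι ℂ) * diagonal (fun i => (w i : ℂ)) * star (U : Matrix ι ι ℂ) =
      U * diagonal (fun i => ((b - w i : ℝ) : ℂ)) * star (U : Matrix ι ι ℂ) := by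
  have h1 : b • (1 : Matrix ι ι ℂ) =
      (U : Matrix ι ι ℂ) * diagonal (fun _ => (b : ℂ)) * star (U : Matrix ι ι ℂ) := by
    have : (diagonal fun _ : ι => (b : ℂ)) = b • (1 : Matrix ι ι ℂ) := by
      ext i j; simp [diagonal_apply, one_apply]
    rw [this]; simp
  rw [h1, ← sub_mul, ← mul_sub, diagonal_sub]
  simp only [Complex.ofReal_sub]

/-- The Markov step: if `A ≤ b` fails, then some eigenvalue of `A` exceeds `b`. -/
theorem exp_le_trace_exp_of_not_le {A : Matrix ι ι ℂ} (hA : A.IsHermitian) {b : ℝ}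
    (h : ¬ (b • 1 - A).PosSemidef) : Real.exp b ≤ (NormedSpace.exp A).trace.re := by
  obtain ⟨U, w, rfl⟩ := exists_unitary_diagonal hA
  rw [smul_one_sub_unitary_conj_diagonal, posSemidef_unitary_conj_diagonal_iff] at h
  push Not at h
  obtain ⟨i, hi⟩ := h
  rw [exp_unitary_conj_diagonal, trace_unitary_conj_diagonal]
  exact (Real.exp_le_exp.2 (by linarith)).trans
    (Finset.single_le_sum (f := fun i => Real.exp (w i)) (fun j _ => (Real.exp_pos _).le)
      (Finset.mem_univ i))

theorem posSemidef_exp_sub_one {A : Matrix ι ι ℂ} (hA : A.PosSemidef) :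
    (NormedSpace.exp A - 1).PosSemidef := by
  obtain ⟨U, w, rfl⟩ := exists_unitary_diagonal hA.1
  rw [posSemidef_unitary_conj_diagonal_iff] at hA
  have := smul_one_sub_unitary_conj_diagonal U (fun i => Real.exp (w i)) 1
  rw [one_smul] at this
  have hneg : (-diagonal fun i => ((1 - Real.exp (w i) : ℝ) : ℂ)) =
      diagonal fun i => ((Real.exp (w i) - 1 : ℝ) : ℂ) := by
    rw [diagonal_neg]
    congr 1
    funext i
    simp
  rw [exp_unitary_conj_diagonal, ← neg_sub, this, ← neg_mul, ← mul_neg, hneg,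
    posSemidef_unitary_conj_diagonal_iff]
  exact fun i => sub_nonneg.2 (Real.one_le_exp (hA i))

/-- The trace of `exp A - 1`, unlike that of `exp A`, does not see the kernel of `A`. -/
theorem exp_sub_one_le_trace_exp_sub_one_of_not_le {A : Matrix ι ι ℂ} (hA : A.PosSemidef) {b : ℝ}
    (h : ¬ (b • 1 - A).PosSemidef) : Real.exp b - 1 ≤ (NormedSpace.exp A - 1).trace.re := by
  obtain ⟨U, w, rfl⟩ := exists_unitary_diagonal hA.1
  rw [posSemidef_unitary_conj_diagonal_iff] at hA
  rw [smul_one_sub_unitary_conj_diagonal, posSemidef_unitary_conj_diagonal_iff] at h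
  push Not at h
  obtain ⟨i, hi⟩ := h
  rw [exp_unitary_conj_diagonal, trace_sub, Complex.sub_re, trace_unitary_conj_diagonal, trace_one,
    Complex.natCast_re, ← Finset.card_univ, ← nsmul_one, ← Finset.sum_const,
    ← Finset.sum_sub_distrib]
  refine le_trans ?_ (Finset.single_le_sum (f := fun i => Real.exp (w i) - 1)
    (fun j _ => by linarith [Real.one_le_exp (hA j)]) (Finset.mem_univ i))
  linarith [Real.exp_le_exp.2 (show b ≤ w i by linarith)]

theorem trace_mul_nonneg {A C : Matrix ι ι ℂ} (hA : A.PosSemidef) (hC : C.PosSemidef) :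
    0 ≤ (A * C).trace.re := by
  obtain ⟨U, w, rfl⟩ := exists_unitary_diagonal hA.1
  rw [posSemidef_unitary_conj_diagonal_iff] at hA
  have hD := hC.conjTranspose_mul_mul_same (U : Matrix ι ι ℂ)
  rw [mul_assoc, mul_assoc, trace_mul_comm, mul_assoc, mul_assoc, ← mul_assoc _ C, Matrix.trace,
    Complex.re_sum]
  refine Finset.sum_nonneg fun i _ => ?_
  rw [diag_apply, diagonal_mul, Complex.re_ofReal_mul]
  exact mul_nonneg (hA i) (Complex.le_def.1 (hD.diag_nonneg (i := i))).1

end Spectral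

/-! ### Exponential moments of sums of rank-one matrices -/

section Chernoff

variable {ι κ : Type*} [Fintype ι] [Fintype κ]

/-- The Gram-type sum `∑ⱼ vⱼ vⱼ*` of the rank-one matrices of a family of vectors. -/
noncomputable def outerSum {μ : Type*} [Fintype μ] (v : μ → ι → ℂ) : Matrix ι ι ℂ :=
  ∑ j, vecMulVec (v j) (star (v j))

theorem posSemidef_outerSum {μ : Type*} [Fintype μ] (v : μ → ι → ℂ) : (outerSum v).PosSemidef :=
  posSemidef_sum _ fun j _ => posSemidef_vecMulVec_self_star (v j)

variable [DecidableEq ι]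

/-- The square of `v v*` is `c v v*`, so the exponential series collapses. -/
theorem exp_smul_vecMulVec {v : ι → ℂ} {c : ℝ} (hc : c ≠ 0) (hv : star v ⬝ᵥ v = (c : ℂ)) (s : ℝ) :
    NormedSpace.exp (s • vecMulVec v (star v)) =
      1 + ((Real.exp (s * c) - 1) / c) • vecMulVec v (star v) := by
  set X := vecMulVec v (star v) with hX
  have hXX : X * X = c • X := by
    rw [hX, vecMulVec_mul_vecMulVec, hv]
    ext i j; simp [vecMulVec_apply, mul_left_comm]
  have hpow : ∀ k : ℕ, X ^ (k + 1) = c ^ k • X := by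
    intro k
    induction k with
    | zero => simp
    | succ k ih => rw [pow_succ, ih, smul_mul_assoc, hXX, smul_smul, ← pow_succ]
  have hsum : HasSum (fun k : ℕ => ((k.factorial : ℝ)⁻¹) • (s • X) ^ k)
      (1 + ((Real.exp (s * c) - 1) / c) • X) := by
    -- The zeroth term is `1`, not a multiple of `X`, and is split off.
    rw [hasSum_nat_add_iff' 1 |>.symm]
    have h0 := NormedSpace.exp_series_hasSum_exp' (𝕂 := ℝ) (s * c)
    rw [← Real.exp_eq_exp_ℝ, ← hasSum_nat_add_iff' 1] at h0
    have h1 := (h0.div_const c).smul_const X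
    convert! h1 using 1
    · funext k
      rw [smul_pow, hpow, smul_smul, smul_smul]
      congr 1
      rw [smul_eq_mul, mul_pow, pow_succ c]
      field_simp
    · simp
  rw [NormedSpace.exp_eq_tsum ℝ]
  exact hsum.tsum_eq

theorem sum_fin_succ_fun {M : Type*} [AddCommMonoid M] (m : ℕ) (g : (Fin (m + 1) → κ) → M) :
    ∑ f, g f = ∑ f : Fin m → κ, ∑ k, g (Fin.cons k f) := by
  rw [Finset.sum_comm, ← (Fin.consEquiv fun _ => κ).sum_comp, Fintype.sum_prod_type]
  rfl

variable {v : κ → ι → ℂ} {c : ℝ}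

/-- Golden–Thompson peels one of the independent rank-one summands off the exponential. -/
theorem sum_trace_exp_succ_le (hc : c ≠ 0) (hv : ∀ k, star (v k) ⬝ᵥ v k = (c : ℂ)) (s : ℝ) (m : ℕ) :
    ∑ f : Fin (m + 1) → κ, (NormedSpace.exp (s • outerSum fun j => v (f j))).trace.re ≤
      ∑ f : Fin m → κ, (NormedSpace.exp (s • outerSum fun j => v (f j)) *
        ((Fintype.card κ : ℝ) • 1 + ((Real.exp (s * c) - 1) / c) • outerSum v)).trace.re := by
  rw [sum_fin_succ_fun]
  refine Finset.sum_le_sum fun f _ => ?_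
  have hsplit : ∀ k, (outerSum fun j => v ((Fin.cons k f : Fin (m + 1) → κ) j)) =
      (outerSum fun j => v (f j)) + vecMulVec (v k) (star (v k)) := by
    intro k
    simp [outerSum, Fin.sum_univ_succ, add_comm]
  have hherm : ∀ {C : Matrix ι ι ℂ}, C.IsHermitian → (s • C).IsHermitian :=
    fun hC => hC.smul (IsSelfAdjoint.all s)
  calc _ ≤ ∑ k, (NormedSpace.exp (s • outerSum fun j => v (f j)) *
        (1 + ((Real.exp (s * c) - 1) / c) • vecMulVec (v k) (star (v k)))).trace.re := by
        refine Finset.sum_le_sum fun k _ => ?_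
        rw [hsplit, smul_add, ← exp_smul_vecMulVec hc (hv k)]
        exact trace_exp_add_le (hherm (posSemidef_outerSum _).1)
          (hherm (posSemidef_vecMulVec_self_star (v k)).1)
    _ = _ := by
        rw [← Complex.re_sum, ← trace_sum, ← Finset.mul_sum, Finset.sum_add_distrib,
          ← Finset.smul_sum, Finset.sum_const, Finset.card_univ, ← Nat.cast_smul_eq_nsmul ℝ]
        rfl

open scoped Classical in
/-- Matrix Chernoff bound for an isotropic family, counting the maps for which
`s • ∑ⱼ v_{f j} v_{f j}* ≤ b` fails. The parameter `s` may be negative, which gives lower bounds for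
the sum. -/
theorem card_not_le_of_isotropic (hc : c ≠ 0) (hv : ∀ k, star (v k) ⬝ᵥ v k = (c : ℂ))
    (hiso : outerSum v = (Fintype.card κ : ℝ) • 1) (s b : ℝ) (m : ℕ) 
    (hg : 0 ≤ 1 + (Real.exp (s * c) - 1) / c) :
    ((Finset.univ.filter fun f : Fin m → κ =>
        ¬ (b • 1 - s • outerSum fun j => v (f j)).PosSemidef).card : ℝ) ≤
      Fintype.card ι * Real.exp (-b) * (1 + (Real.exp (s * c) - 1) / c) ^ m *
        (Fintype.card κ : ℝ) ^ m := by
  set g := 1 + (Real.exp (s * c) - 1) / c with hgdef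
  have htr : ∀ m : ℕ,
      ∑ f : Fin m → κ, (NormedSpace.exp (s • outerSum fun j => v (f j))).trace.re ≤
        Fintype.card ι * (g * Fintype.card κ) ^ m := by
    intro m
    induction m with
    | zero => simp [outerSum]
    | succ m ih =>
      refine (sum_trace_exp_succ_le hc hv s m).trans ?_
      have : (Fintype.card κ : ℝ) • (1 : Matrix ι ι ℂ) +
          ((Real.exp (s * c) - 1) / c) • outerSum v = (g * Fintype.card κ) • 1 := by
        rw [hiso, smul_smul, ← add_smul, hgdef]; congr 1; ring
      simp only [this, mul_smul_comm, mul_one, trace_smul, Complex.real_smul, Complex.re_ofReal_mul,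
        ← Finset.mul_sum]
      rw [pow_succ, mul_comm _ (g * _), mul_left_comm]
      gcongr
  have hcard : ((Finset.univ.filter fun f : Fin m → κ =>
        ¬ (b • 1 - s • outerSum fun j => v (f j)).PosSemidef).card : ℝ) * Real.exp b ≤
      ∑ f : Fin m → κ, (NormedSpace.exp (s • outerSum fun j => v (f j))).trace.re := by
    have hherm : ∀ f : Fin m → κ, (s • outerSum fun j => v (f j)).IsHermitian :=
      fun f => (posSemidef_outerSum _).1.smul (IsSelfAdjoint.all s)
    rw [← nsmul_eq_mul, ← Finset.sum_const]
    refine (Finset.sum_le_sum fun f hf =>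
      exp_le_trace_exp_of_not_le (hherm f) (Finset.mem_filter.1 hf).2).trans ?_
    refine Finset.sum_le_univ_sum_of_nonneg fun f => ?_
    obtain ⟨U, w, h⟩ := exists_unitary_diagonal (hherm f)
    rw [h, exp_unitary_conj_diagonal, trace_unitary_conj_diagonal]
    exact Finset.sum_nonneg fun i _ => (Real.exp_pos _).le
  have := hcard.trans (htr m)
  rw [← le_div_iff₀ (Real.exp_pos b)] at this
  refine this.trans_eq ?_
  rw [Real.exp_neg, mul_pow]
  field_simp

open scoped Classical in
/-- Upper tail bound whose dimensional factor is the number `m` of samples, not the size of the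
matrices. -/
theorem card_not_le_of_bounded (hc : 0 < c) (hv : ∀ k, star (v k) ⬝ᵥ v k = (c : ℂ))
    {a : ℝ} (ha : 0 ≤ a) (hbd : (a • 1 - outerSum v).PosSemidef) {s b : ℝ}(hs : 0 < s)
    (m : ℕ) :
    ((Finset.univ.filter fun f : Fin m → κ =>
        ¬ (b • 1 - outerSum fun j => v (f j)).PosSemidef).card : ℝ) * (Real.exp (s * b) - 1) ≤
      m * (Real.exp (s * c) - 1) * (Fintype.card κ + (Real.exp (s * c) - 1) / c * a) ^ m := by
  set g := (Real.exp (s * c) - 1) / c with hgdef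
  set N : ℝ := (Fintype.card κ : ℝ) with hN
  have hN0 : 0 ≤ N := by positivity
  have hgc : g * c = Real.exp (s * c) - 1 := by rw [hgdef]; field_simp
  have hg : 0 ≤ g := div_nonneg (by linarith [Real.one_le_exp (mul_pos hs hc).le]) hc.le
  have hpsd : ∀ {m : ℕ} (f : Fin m → κ), (s • outerSum fun j => v (f j)).PosSemidef :=
    fun f => (posSemidef_outerSum _).smul hs.le
  have htrace : (outerSum v).trace.re = N * c := by
    simp [outerSum, trace_sum, trace_vecMulVec, dotProduct_comm (v _), hv, hN]
  have htr : ∀ m : ℕ,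
      ∑ f : Fin m → κ, (NormedSpace.exp (s • outerSum fun j => v (f j)) - 1).trace.re ≤
        m * (g * c) * (N + g * a) ^ m := by
    intro m
    induction m with
    | zero => simp [outerSum]
    | succ m ih =>
      have hstep : ∀ f : Fin m → κ, (NormedSpace.exp (s • outerSum fun j => v (f j)) *
          (N • 1 + g • outerSum v)).trace.re ≤
          (N + g * a) * (NormedSpace.exp (s • outerSum fun j => v (f j)) - 1).trace.re +
            N * Fintype.card ι + g * (N * c) := by
        intro f
        have h0 := trace_mul_nonneg (posSemidef_exp_sub_one (hpsd f)) hbd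
        have h1 : ∀ E : Matrix ι ι ℂ, (E * (N • 1 + g • outerSum v)).trace.re =
            N * (E - 1).trace.re + N * Fintype.card ι + g * ((E - 1) * outerSum v).trace.re +
              g * (outerSum v).trace.re := by
          intro E
          simp [mul_add, sub_mul, trace_sub, trace_add, trace_smul]
          ring
        have h2 : ∀ E : Matrix ι ι ℂ, (E * (a • 1 - outerSum v)).trace.re =
            a * E.trace.re - (E * outerSum v).trace.re := by
          intro E
          simp [mul_sub, trace_sub, trace_smul]
        rw [h2] at h0
        rw [h1, htrace]
        nlinarith [mul_nonneg hg h0]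
      have hsub : ∀ m : ℕ,
          ∑ f : Fin m → κ, (NormedSpace.exp (s • outerSum fun j => v (f j)) - 1).trace.re =
            ∑ f : Fin m → κ, (NormedSpace.exp (s • outerSum fun j => v (f j))).trace.re -
              N ^ m * Fintype.card ι := by
        intro m
        simp [trace_sub, trace_one, hN]
      calc _ = ∑ f : Fin (m + 1) → κ,
              (NormedSpace.exp (s • outerSum fun j => v (f j))).trace.re -
                N ^ (m + 1) * Fintype.card ι := hsub _
        _ ≤ ∑ f : Fin m → κ, ((N + g * a) *
              (NormedSpace.exp (s • outerSum fun j => v (f j)) - 1).trace.re +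
                N * Fintype.card ι + g * (N * c)) - N ^ (m + 1) * Fintype.card ι := by
            gcongr
            exact (sum_trace_exp_succ_le hc.ne' hv s m).trans
              (Finset.sum_le_sum fun f _ => hstep f)
        _ = (N + g * a) * ∑ f : Fin m → κ,
              (NormedSpace.exp (s • outerSum fun j => v (f j)) - 1).trace.re +
                g * c * N ^ (m + 1) := by
            simp only [Finset.sum_add_distrib, ← Finset.mul_sum, Finset.sum_const,
              Finset.card_univ, Fintype.card_fun, Fintype.card_fin, nsmul_eq_mul, Nat.cast_pow,
              ← hN]
            ring
        _ ≤ (N + g * a) * (m * (g * c) * (N + g * a) ^ m) + g * c * (N + g * a) ^ (m + 1) := by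
            gcongr
            exact le_add_of_nonneg_right (by positivity)
        _ = _ := by push_cast; ring
  rw [← hgc]
  refine le_trans ?_ (htr m)
  rw [← nsmul_eq_mul, ← Finset.sum_const]
  refine (Finset.sum_le_sum fun f hf => exp_sub_one_le_trace_exp_sub_one_of_not_le (hpsd f)
    (b := s * b) ?_).trans (Finset.sum_le_univ_sum_of_nonneg fun f =>
      (Complex.le_def.1 (posSemidef_exp_sub_one (hpsd f)).trace_nonneg).1)
  intro h
  refine (Finset.mem_filter.1 hf).2 ?_
  have := h.smul (inv_nonneg.2 hs.le)
  rwa [smul_sub, smul_smul, smul_smul, ← mul_assoc, inv_mul_cancel₀ hs.ne', one_mul,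
    one_smul] at this

end Chernoff

/-! ### From counting to probability -/

section Sampling

open scoped Classical in
theorem one_sub_lt_measureReal_of_card {n m : ℕ} (hn : 0 < n) {Ω : Type*} [MeasurableSpace Ω]
    {P : Measure Ω} [IsProbabilityMeasure P] {J : Fin m → Ω → Fin n} (hindep : iIndepFun J P)
    (hunif : ∀ j, HasLaw (J j) (uniformOn Set.univ) P) {Q : (Fin m → Fin n) → Prop} {δ : ℝ}
    (hQ : ((Finset.univ.filter fun f => ¬ Q f).card : ℝ) < δ * (n : ℝ) ^ m) :
    1 - δ < P.real {ω | Q fun j => J j ω} := by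
  have hmeas : ∀ j, AEMeasurable (J j) P := fun j => (hunif j).aemeasurable
  have hlaw := (iIndepFun_iff_map_fun_eq_pi_map hmeas).1 hindep
  have hpoint : ∀ f : Fin m → Fin n, P.real {ω | (fun j => J j ω) = f} = ((n : ℝ) ^ m)⁻¹ := by
    intro f
    have h1 : P {ω | (fun j => J j ω) = f} = P.map (fun ω j => J j ω) {f} := by
      rw [Measure.map_apply_of_aemeasurable (aemeasurable_pi_lambda _ hmeas)
        (measurableSet_singleton f)]
      rfl
    have h2 : P {ω | (fun j => J j ω) = f} = ((n : ℝ≥0∞)⁻¹) ^ m := by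
      rw [h1, hlaw, Measure.pi_singleton]
      simp [(hunif _).map_eq, uniformOn_univ]
    rw [measureReal_def, h2]
    simp
  have hbad : P.real {ω | ¬ Q fun j => J j ω} ≤
      (Finset.univ.filter fun f => ¬ Q f).card * ((n : ℝ) ^ m)⁻¹ := by
    have hsub : {ω | ¬ Q fun j => J j ω} ⊆
        ⋃ f ∈ Finset.univ.filter (fun f => ¬ Q f), {ω | (fun j => J j ω) = f} := by
      intro ω hω
      simpa using hω
    refine (measureReal_mono hsub (measure_ne_top P _)).trans ((measureReal_biUnion_finset_le _ _).trans_eq ?_)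
    simp [hpoint]
  have hone : 1 ≤ P.real {ω | Q fun j => J j ω} + P.real {ω | ¬ Q fun j => J j ω} := by
    refine le_trans (le_of_eq ?_) (measureReal_union_le _ _)
    rw [← probReal_univ (μ := P)]
    congr 1
    ext ω
    simp [em]
  have hnm : (0 : ℝ) < (n : ℝ) ^ m := by positivity
  have : ((Finset.univ.filter fun f => ¬ Q f).card : ℝ) * ((n : ℝ) ^ m)⁻¹ < δ := by
    rwa [← div_eq_mul_inv, div_lt_iff₀ hnm]
  linarith

end Sampling

/-! ### Quadratic forms and singular values -/

section QuadraticForm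

variable {ι μ : Type*} [Fintype ι] [Fintype μ]

theorem star_dotProduct_outerSum_mulVec (v : μ → ι → ℂ) (x : ι → ℂ) :
    star x ⬝ᵥ (outerSum v *ᵥ x) = ((∑ j, ‖star (v j) ⬝ᵥ x‖ ^ 2 : ℝ) : ℂ) := by
  rw [outerSum, sum_mulVec, dotProduct_sum, Complex.ofReal_sum]
  refine Finset.sum_congr rfl fun j _ => ?_
  rw [vecMulVec_mulVec, op_smul_eq_smul, dotProduct_smul, smul_eq_mul, Complex.ofReal_pow, ← Complex.mul_conj',
    ← Complex.star_def, star_dotProduct, star_star]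

theorem star_dotProduct_self_eq (x : ι → ℂ) : star x ⬝ᵥ x = ((∑ i, ‖x i‖ ^ 2 : ℝ) : ℂ) := by
  simp [dotProduct, ← Complex.conj_mul']

variable [DecidableEq ι]

theorem posSemidef_smul_one_sub_outerSum_iff (v : μ → ι → ℂ) (b : ℝ) :
    (b • 1 - outerSum v).PosSemidef ↔
      ∀ x : ι → ℂ, ∑ j, ‖star (v j) ⬝ᵥ x‖ ^ 2 ≤ b * ∑ i, ‖x i‖ ^ 2 := by
  have hherm : (b • 1 - outerSum v).IsHermitian :=
    (isHermitian_one.smul (IsSelfAdjoint.all b)).sub (posSemidef_outerSum v).1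
  rw [posSemidef_iff_dotProduct_mulVec, and_iff_right hherm]
  refine forall_congr' fun x => ?_
  rw [sub_mulVec, dotProduct_sub, star_dotProduct_outerSum_mulVec, smul_mulVec, one_mulVec,
    dotProduct_smul, star_dotProduct_self_eq, Complex.real_smul, ← Complex.ofReal_mul,
    ← Complex.ofReal_sub, Complex.zero_le_real, sub_nonneg]

/-- Each singular value is attained at an eigenvector of the adjoint times the map. The index bound
excludes the zeros with which Mathlib continues the list of singular values. -/
theorem exists_norm_sq_mulVec_eq_singularValues (A : Matrix μ ι ℂ) {i : ℕ}
    (hi : i < Fintype.card ι) :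
    ∃ x : ι → ℂ, 0 < ∑ h, ‖x h‖ ^ 2 ∧
      ∑ j, ‖(A *ᵥ x) j‖ ^ 2 =
        (Matrix.toEuclideanLin A).singularValues i ^ 2 * ∑ h, ‖x h‖ ^ 2 := by
  obtain ⟨x, hx⟩ := ((Matrix.toEuclideanLin A).hasEigenvalue_adjoint_comp_self_sq_singularValues
    (n := i) (by simpa using hi)).exists_hasEigenvector
  have h1 := hx.apply_eq_smul
  have h2 : inner ℂ ((Matrix.toEuclideanLin A) x) ((Matrix.toEuclideanLin A) x) =
      inner ℂ x ((((Matrix.toEuclideanLin A).singularValues i : ℂ) ^ 2) • x) := by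
    rw [← LinearMap.adjoint_inner_right, ← LinearMap.comp_apply]
    exact congrArg _ h1
  rw [inner_smul_right, inner_self_eq_norm_sq_to_K, inner_self_eq_norm_sq_to_K] at h2
  refine ⟨x.ofLp, ?_, ?_⟩
  · rw [← EuclideanSpace.norm_sq_eq]
    exact pow_pos (norm_pos_iff.2 hx.2) 2
  · rw [← EuclideanSpace.norm_sq_eq x]
    have h3 := EuclideanSpace.norm_sq_eq ((Matrix.toEuclideanLin A) x)
    have h4 : ‖(Matrix.toEuclideanLin A) x‖ ^ 2 =
        (Matrix.toEuclideanLin A).singularValues i ^ 2 * ‖x‖ ^ 2 := by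
      apply Complex.ofReal_injective
      push_cast
      exact h2
    rw [← h4, h3]
    rfl

variable [Nonempty ι]

theorem sigmaMax_sq_le {A : Matrix μ ι ℂ} {b : ℝ}
    (h : ∀ x : ι → ℂ, ∑ j, ‖(A *ᵥ x) j‖ ^ 2 ≤ b * ∑ i, ‖x i‖ ^ 2) : sigmaMax A ^ 2 ≤ b := by
  obtain ⟨x, hx0, hx⟩ := exists_norm_sq_mulVec_eq_singularValues A (i := 0) Fintype.card_pos
  exact le_of_mul_le_mul_right (hx ▸ h x) hx0

theorem le_sigmaMin_sq {A : Matrix μ ι ℂ} {b : ℝ}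
    (h : ∀ x : ι → ℂ, b * ∑ i, ‖x i‖ ^ 2 ≤ ∑ j, ‖(A *ᵥ x) j‖ ^ 2) : b ≤ sigmaMin A ^ 2 := by
  obtain ⟨x, hx0, hx⟩ := exists_norm_sq_mulVec_eq_singularValues A
    (i := Fintype.card ι - 1) (Nat.sub_lt Fintype.card_pos one_pos)
  exact le_of_mul_le_mul_right (hx ▸ h x) hx0

end QuadraticForm

/-! ### The spectral norm with infinitely many columns -/

section SpectralNorm

variable {κ ι : Type*} [Fintype κ]

/-- The bound on the unit ball, freed from the normalization: the vectors are replaced by arbitrary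
coefficients on a finite set of columns. -/
theorem specNorm_sq_le_iff (A : Matrix κ ι ℂ) {b : ℝ} (hb : 0 ≤ b) :
    specNorm A ^ 2 ≤ ENNReal.ofReal b ↔ ∀ (F : Finset ι) (x : ι → ℂ),
      ∑ j, ‖∑ i ∈ F, A j i * x i‖ ^ 2 ≤ b * ∑ i ∈ F, ‖x i‖ ^ 2 := by
  classical
  have hsq : ∀ y : κ → ℂ, ‖(WithLp.toLp 2 y : EuclideanSpace ℂ κ)‖ₑ ≤ ENNReal.ofReal (√b) ↔
      ∑ j, ‖y j‖ ^ 2 ≤ b := by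
    intro y
    rw [← ofReal_norm, ENNReal.ofReal_le_ofReal_iff (Real.sqrt_nonneg b),
      Real.le_sqrt (norm_nonneg _) hb, EuclideanSpace.norm_sq_eq]
  have hroot : specNorm A ^ 2 ≤ ENNReal.ofReal b ↔ specNorm A ≤ ENNReal.ofReal (√b) := by
    conv_lhs => rw [← Real.sq_sqrt hb, ENNReal.ofReal_pow (Real.sqrt_nonneg b)]
    exact ENNReal.pow_le_pow_left_iff two_ne_zero
  rw [hroot, specNorm, iSup₂_le_iff]
  constructor
  · intro h F x
    set s := ∑ i ∈ F, ‖x i‖ ^ 2 with hs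
    have hs0 : 0 ≤ s := Finset.sum_nonneg fun i _ => by positivity
    rcases hs0.eq_or_lt with h0 | h0
    · have hx : ∀ i ∈ F, x i = 0 := fun i hi => by
        have := (Finset.sum_eq_zero_iff_of_nonneg (fun i _ => by positivity)).1 h0.symm i hi
        simpa using this
      have : ∀ j, ∑ i ∈ F, A j i * x i = 0 := fun j =>
        Finset.sum_eq_zero fun i hi => by rw [hx i hi, mul_zero]
      simp [this, ← h0]
    · set y : ι →₀ ℂ := Finsupp.onFinset F
        (fun i => if i ∈ F then ((√s)⁻¹ : ℂ) * x i else 0) (fun i hi => by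
          by_contra hF; simp [hF] at hi) with hy
      have hsupp : y.support ⊆ F := Finsupp.support_onFinset_subset
      have hyF : ∀ i ∈ F, y i = ((√s)⁻¹ : ℂ) * x i := fun i hi => by simp [hy, hi]
      have hys : ∑ i ∈ y.support, ‖y i‖ ^ 2 ≤ 1 := by
        rw [Finset.sum_subset hsupp fun i _ hi => by simp [Finsupp.notMem_support_iff.1 hi],
          Finset.sum_congr rfl fun i hi => by rw [hyF i hi, norm_mul, mul_pow], ← Finset.mul_sum,
          ← hs]
        simp [Real.sq_sqrt hs0, h0.ne']
      have h1 := (hsq _).1 (h y hys)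
      have h2 : ∀ j, ∑ i ∈ y.support, A j i * y i = ((√s)⁻¹ : ℂ) * ∑ i ∈ F, A j i * x i := by
        intro j
        rw [Finset.sum_subset hsupp fun i _ hi => by simp [Finsupp.notMem_support_iff.1 hi],
          Finset.mul_sum]
        exact Finset.sum_congr rfl fun i hi => by rw [hyF i hi, mul_left_comm]
      simp only [h2, norm_mul, mul_pow, ← Finset.mul_sum] at h1
      have h3 : ‖((√s)⁻¹ : ℂ)‖ ^ 2 = s⁻¹ := by
        simp [Real.sq_sqrt hs0]
      rwa [h3, inv_mul_le_iff₀ h0, mul_comm] at h1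
  · intro h y hy
    rw [hsq]
    exact (h y.support y).trans (mul_le_of_le_one_right hb hy)

end SpectralNorm

/-! ### The matrices of a rank-1 lattice -/

section Lattice

variable {d n : ℕ}

theorem norm_latticeExp (z : Fin d → ℤ) (k : Fin n) (h : Fin d → ℤ) : ‖latticeExp z k h‖ = 1 := by
  have : latticeExp z k h =
      Complex.exp ((2 * Real.pi * (((k : ℕ) : ℝ) / n) * ((h ⬝ᵥ z : ℤ) : ℝ) : ℝ) * Complex.I) := by
    rw [latticeExp]; congr 1; push_cast; ring
  rw [this, Complex.norm_exp_ofReal_mul_I]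

/-- Character orthogonality: a geometric sum over the `n`-th roots of unity. -/
theorem sum_star_latticeExp_mul (hn : 0 < n) (z : Fin d → ℤ) {h h' : Fin d → ℤ}
    (hne : ¬ h ⬝ᵥ z ≡ h' ⬝ᵥ z [ZMOD (n : ℤ)]) :
    ∑ k : Fin n, star (latticeExp z k h) * latticeExp z k h' = 0 := by
  have hn' : (n : ℂ) ≠ 0 := by exact_mod_cast hn.ne'
  set a : ℤ := h' ⬝ᵥ z - h ⬝ᵥ z with ha
  set w := Complex.exp (2 * Real.pi * Complex.I * ((a : ℂ) / n)) with hw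
  have hterm : ∀ k : Fin n, star (latticeExp z k h) * latticeExp z k h' = w ^ (k : ℕ) := by
    intro k
    rw [latticeExp, latticeExp, Complex.star_def, ← Complex.exp_conj, ← Complex.exp_add, hw,
      ← Complex.exp_nat_mul, ha]
    congr 1
    simp only [map_mul, map_div₀, Complex.conj_I, Complex.conj_ofReal, map_natCast, map_intCast,
      map_ofNat]
    push_cast
    ring
  have hwn : w ^ n = 1 := by
    rw [hw, ← Complex.exp_nat_mul, Complex.exp_eq_one_iff]
    exact ⟨a, by field_simp⟩
  have hw1 : w ≠ 1 := by
    intro h1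
    rw [hw, Complex.exp_eq_one_iff] at h1
    obtain ⟨q, hq⟩ := h1
    have h2 : (a : ℂ) / n = q := by
      have h3 : (2 * Real.pi * Complex.I : ℂ) ≠ 0 := Complex.two_pi_I_ne_zero
      exact mul_left_cancel₀ h3 (by rw [hq]; ring)
    rw [div_eq_iff hn'] at h2
    have h4 : a = q * n := by exact_mod_cast h2
    exact hne ((Int.modEq_iff_dvd).2 ⟨q, by rw [← ha, h4, mul_comm]⟩)
  simp only [hterm]
  rw [Fin.sum_univ_eq_sum_range (fun k => w ^ k), geom_sum_eq hw1, hwn]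
  simp

theorem star_rowL_dotProduct_self (z : Fin d → ℤ) (B : Finset (Fin d → ℤ)) (k : Fin n) :
    star (fun h : B => star (latticeExp z k h)) ⬝ᵥ (fun h : B => star (latticeExp z k h)) =
      ((B.card : ℝ) : ℂ) := by
  rw [star_dotProduct_self_eq]
  simp [norm_latticeExp]

/-- The reconstructing property makes the rows of `L` over the full lattice a tight frame. -/
theorem outerSum_rowL (hn : 0 < n) (z : Fin d → ℤ) {B : Finset (Fin d → ℤ)}
    (hrec : Reconstructing n z B) :
    outerSum (fun (k : Fin n) (h : B) => star (latticeExp z k h)) =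
      (Fintype.card (Fin n) : ℝ) • 1 := by
  ext h h'
  rw [outerSum, Matrix.sum_apply]
  simp only [vecMulVec_apply, Pi.star_apply, star_star]
  by_cases hh : h = h'
  · subst hh
    have : ∀ k : Fin n, star (latticeExp z k h) * latticeExp z k h = 1 := fun k => by
      rw [Complex.star_def, Complex.conj_mul', norm_latticeExp]; simp
    rw [Finset.sum_congr rfl fun k _ => this k]
    simp
  · rw [sum_star_latticeExp_mul hn z (hrec h h.2 h' h'.2 fun e => hh (Subtype.ext e))]
    simp [hh]

theorem matrixL_mulVec (z : Fin d → ℤ) (B : Finset (Fin d → ℤ)) {κ : Type*} (f : κ → Fin n)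
    (x : B → ℂ) (j : κ) :
    (matrixL z B f *ᵥ x) j = star (fun h : B => star (latticeExp z (f j) h)) ⬝ᵥ x := by
  simp [matrixL, mulVec, dotProduct]

/-- The sample size is large enough to absorb the dimensional factor `N` of the Chernoff bound, once
the exponent per `m / N` is below `-1/12`. -/
theorem lt_exp_neg_of_tail {p K t : ℝ} {N m : ℕ} (hN : 0 < N) (ht : 0 < t) (hp : p < -(1 / 12))
    (hm : 12 * (N : ℝ) * (Real.log N + t) ≤ m) (h : K ≤ N * Real.exp (m / N * p)) :
    K < Real.exp (-t) := by
  refine h.trans_lt ?_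
  have hN' : (0 : ℝ) < N := by exact_mod_cast hN
  have hlog : 0 ≤ Real.log N := Real.log_nonneg (by exact_mod_cast hN)
  have hmN : 12 * (Real.log N + t) ≤ m / N := by
    rw [le_div_iff₀ hN']; linarith
  calc (N : ℝ) * Real.exp (m / N * p) = Real.exp (Real.log N + m / N * p) := by
        rw [Real.exp_add, Real.exp_log hN']
    _ < Real.exp (-t) := Real.exp_lt_exp.2 (by nlinarith)

open scoped Classical in
theorem card_sigmaMin_lt (hn : 0 < n) {m : ℕ} (z : Fin d → ℤ) {B : Finset (Fin d → ℤ)}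
    (hB : B.Nonempty) (hrec : Reconstructing n z B) {t : ℝ} (ht : 0 < t)
    (hm : 12 * (B.card : ℝ) * (Real.log B.card + t) ≤ m) :
    ((Finset.univ.filter fun f : Fin m → Fin n =>
      ¬ (m : ℝ) / 2 ≤ sigmaMin (matrixL z B f) ^ 2).card : ℝ) < Real.exp (-t) * (n : ℝ) ^ m := by
  have : Nonempty B := hB.to_subtype
  have hN : 0 < B.card := hB.card_pos
  have hN' : (0 : ℝ) < B.card := by exact_mod_cast hN
  have hN1 : (1 : ℝ) ≤ B.card := by exact_mod_cast hN
  have hnm : (0 : ℝ) < (n : ℝ) ^ m := by positivity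
  -- The Chernoff exponent `e^u - 1 - u / 2` is minimal at `u = -log 2`.
  set s := -Real.log 2 / B.card with hs
  have hexp : Real.exp (s * B.card) - 1 = -(1 / 2) := by
    rw [hs, div_mul_cancel₀ _ hN'.ne', Real.exp_neg, Real.exp_log two_pos]; norm_num
  have hchern := card_not_le_of_isotropic hN'.ne' (star_rowL_dotProduct_self z B)
    (outerSum_rowL hn z hrec) s (s * (m / 2)) m (by
      rw [hexp]
      have : 1 / 2 / (B.card : ℝ) ≤ 1 := by rw [div_le_one hN']; linarith
      linarith [neg_div (B.card : ℝ) (1 / 2)])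
  rw [hexp, Fintype.card_fin, Fintype.card_coe] at hchern
  refine (Nat.cast_le.2 (Finset.card_le_card ?_)).trans_lt (lt_of_le_of_lt hchern ?_)
  · refine Finset.monotone_filter_right _ fun f _ hf hpsd => hf (le_sigmaMin_sq fun x => ?_)
    have hsneg : 0 < -s := by rw [hs, neg_div, neg_neg]; positivity
    have h1 := (posSemidef_iff_dotProduct_mulVec.1 hpsd).2 x
    rw [sub_mulVec, dotProduct_sub, smul_mulVec, smul_mulVec, one_mulVec, dotProduct_smul,
      dotProduct_smul, star_dotProduct_self_eq, star_dotProduct_outerSum_mulVec, Complex.real_smul,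
      Complex.real_smul, ← Complex.ofReal_mul, ← Complex.ofReal_mul, ← Complex.ofReal_sub,
      Complex.zero_le_real] at h1
    simp only [matrixL_mulVec]
    refine le_of_mul_le_mul_left ?_ hsneg
    linarith
  · refine mul_lt_mul_of_pos_right ?_ hnm
    refine lt_exp_neg_of_tail (p := Real.log 2 / 2 - 1 / 2) hN ht
      (by linarith [Real.log_two_lt_d9]) hm ?_
    rw [mul_assoc]
    refine mul_le_mul_of_nonneg_left ?_ hN'.le
    have h1 : (1 + -(1 / 2) / (B.card : ℝ)) ^ m ≤ Real.exp (-(1 / 2) / (B.card : ℝ)) ^ m := by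
      refine pow_le_pow_left₀ ?_ (by linarith [Real.add_one_le_exp (-(1 / 2) / (B.card : ℝ))]) m
      have : 1 / 2 / (B.card : ℝ) ≤ 1 := by rw [div_le_one hN']; linarith
      linarith [neg_div (B.card : ℝ) (1 / 2)]
    refine (mul_le_mul_of_nonneg_left h1 (Real.exp_pos _).le).trans_eq ?_
    rw [← Real.exp_nat_mul, ← Real.exp_add, hs]
    congr 1
    field_simp
    ring

open scoped Classical in
theorem card_lt_sigmaMax (hn : 0 < n) {m : ℕ} (z : Fin d → ℤ) {B : Finset (Fin d → ℤ)}
    (hB : B.Nonempty) (hrec : Reconstructing n z B) {t : ℝ} (ht : 0 < t)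
    (hm : 12 * (B.card : ℝ) * (Real.log B.card + t) ≤ m) :
    ((Finset.univ.filter fun f : Fin m → Fin n =>
      ¬ sigmaMax (matrixL z B f) ^ 2 ≤ 3 * (m : ℝ) / 2).card : ℝ) <
        Real.exp (-t) * (n : ℝ) ^ m := by
  have : Nonempty B := hB.to_subtype
  have hN : 0 < B.card := hB.card_pos
  have hN' : (0 : ℝ) < B.card := by exact_mod_cast hN
  have hnm : (0 : ℝ) < (n : ℝ) ^ m := by positivity
  -- The Chernoff exponent `e^u - 1 - 3 u / 2` is minimal at `u = log (3 / 2)`.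
  set s := Real.log (3 / 2) / B.card with hs
  have hexp : Real.exp (s * B.card) - 1 = 1 / 2 := by
    rw [hs, div_mul_cancel₀ _ hN'.ne', Real.exp_log (by norm_num)]; norm_num
  have hchern := card_not_le_of_isotropic hN'.ne' (star_rowL_dotProduct_self z B)
    (outerSum_rowL hn z hrec) s (s * (3 * m / 2)) m (by rw [hexp]; positivity)
  rw [hexp, Fintype.card_fin, Fintype.card_coe] at hchern
  refine (Nat.cast_le.2 (Finset.card_le_card ?_)).trans_lt (lt_of_le_of_lt hchern ?_)
  · refine Finset.monotone_filter_right _ fun f _ hf hpsd => hf (sigmaMax_sq_le fun x => ?_)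
    have hspos : 0 < s := div_pos (Real.log_pos (by norm_num)) hN'
    have h1 := (posSemidef_iff_dotProduct_mulVec.1 hpsd).2 x
    rw [sub_mulVec, dotProduct_sub, smul_mulVec, smul_mulVec, one_mulVec, dotProduct_smul,
      dotProduct_smul, star_dotProduct_self_eq, star_dotProduct_outerSum_mulVec, Complex.real_smul,
      Complex.real_smul, ← Complex.ofReal_mul, ← Complex.ofReal_mul, ← Complex.ofReal_sub,
      Complex.zero_le_real] at h1
    simp only [matrixL_mulVec]
    refine le_of_mul_le_mul_left ?_ hspos
    linarith
  · refine mul_lt_mul_of_pos_right ?_ hnm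
    -- This is `e ^ 7 < (3 / 2) ^ 18`.
    have hlog : 7 / 18 < Real.log (3 / 2) := by
      rw [Real.lt_log_iff_exp_lt (by norm_num)]
      refine lt_of_pow_lt_pow_left₀ 18 (by norm_num) ?_
      rw [← Real.exp_nat_mul, show ((18 : ℕ) : ℝ) * (7 / 18) = (7 : ℕ) * 1 by norm_num,
        Real.exp_nat_mul]
      exact (pow_lt_pow_left₀ Real.exp_one_lt_d9 (Real.exp_pos _).le (by norm_num)).trans
        (by norm_num)
    refine lt_exp_neg_of_tail (p := 1 / 2 - 3 / 2 * Real.log (3 / 2)) hN ht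
      (by linarith) hm ?_
    rw [mul_assoc]
    refine mul_le_mul_of_nonneg_left ?_ hN'.le
    have h1 : (1 + 1 / 2 / (B.card : ℝ)) ^ m ≤ Real.exp (1 / 2 / (B.card : ℝ)) ^ m :=
      pow_le_pow_left₀ (by positivity) (by linarith [Real.add_one_le_exp (1 / 2 / (B.card : ℝ))]) m
    refine (mul_le_mul_of_nonneg_left h1 (Real.exp_pos _).le).trans_eq ?_
    rw [← Real.exp_nat_mul, ← Real.exp_add, hs]
    congr 1
    field_simp
    ring

/-- Numerical form of the tail estimate with dimensional factor `m`. -/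
theorem lt_exp_neg_mul_of_bounded_tail {K N a c t : ℝ} {m : ℕ} (hN : 0 < N) (ha : 0 ≤ a)
    (hc : 0 < c) (hm : 3 ≤ m) (ht : 0 < t) (hK0 : 0 ≤ K)
    (h : K * (Real.exp (c⁻¹ * (21 * (Real.log m + t) * c + 2 * (m / N) * a)) - 1) ≤
      m * (Real.exp (c⁻¹ * c) - 1) * (N + (Real.exp (c⁻¹ * c) - 1) / c * a) ^ m) :
    K < Real.exp (-t) * N ^ m := by
  have hm' : (3 : ℝ) ≤ m := by exact_mod_cast hm
  rw [inv_mul_cancel₀ hc.ne'] at h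
  have he : Real.exp 1 - 1 ≤ 2 := by linarith [Real.exp_one_lt_d9]
  have he0 : 0 ≤ Real.exp 1 - 1 := by linarith [Real.add_one_le_exp (1 : ℝ)]
  set β := a / c * (m / N) with hβ
  have hβ0 : 0 ≤ β := by positivity
  set q := (m : ℝ) * Real.exp t with hq
  have hq3 : 3 ≤ q := by nlinarith [Real.one_le_exp ht.le]
  have hE : Real.exp (c⁻¹ * (21 * (Real.log m + t) * c + 2 * (m / N) * a)) =
      q ^ 21 * Real.exp (2 * β) := by
    rw [hq, ← Real.exp_log (show (0 : ℝ) < m by linarith), ← Real.exp_add, ← Real.exp_nat_mul,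
      ← Real.exp_add, Real.exp_log (show (0 : ℝ) < m by linarith), hβ]
    congr 1
    field_simp
    push_cast
    ring
  have hpow : (N + (Real.exp 1 - 1) / c * a) ^ m ≤ N ^ m * Real.exp (2 * β) := by
    have h1 : N + (Real.exp 1 - 1) / c * a ≤ N * Real.exp (2 * (a / c / N)) := by
      have h2 := Real.add_one_le_exp (2 * (a / c / N))
      have h3 : (Real.exp 1 - 1) / c * a ≤ 2 * (a / c) := by
        rw [div_mul_eq_mul_div, mul_div_assoc]
        exact mul_le_mul_of_nonneg_right he (by positivity)
      calc _ ≤ N + 2 * (a / c) := by linarith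
        _ = N * (2 * (a / c / N) + 1) := by field_simp; ring
        _ ≤ _ := by gcongr
    refine (pow_le_pow_left₀ (by positivity) h1 m).trans_eq ?_
    rw [mul_pow, ← Real.exp_nat_mul, hβ]
    congr 2
    field_simp
  have hG : 1 ≤ Real.exp (2 * β) := Real.one_le_exp (by positivity)
  set G := Real.exp (2 * β)
  have hNm : 0 < N ^ m := by positivity
  have hq21 : 2 * q < q ^ 21 - 1 := by
    have h1 : 3 ≤ q ^ 20 := hq3.trans (le_self_pow₀ (by linarith) (by norm_num))
    nlinarith [pow_succ q 20]
  have hmain : K * (q ^ 21 - 1) ≤ 2 * m * N ^ m := by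
    refine le_of_mul_le_mul_right ?_ (show 0 < G by linarith)
    rw [hE] at h
    calc K * (q ^ 21 - 1) * G ≤ K * (q ^ 21 * G - 1) := by nlinarith
      _ ≤ _ := h
      _ ≤ m * 2 * (N ^ m * G) := by gcongr
      _ = _ := by ring
  rw [Real.exp_neg, ← div_eq_inv_mul, lt_div_iff₀ (Real.exp_pos t)]
  have hKq : K * (2 * q) < 2 * m * N ^ m ∨ K = 0 := by
    rcases hK0.eq_or_lt with h0 | h0
    · exact Or.inr h0.symm
    · exact Or.inl ((mul_lt_mul_of_pos_left hq21 h0).trans_le hmain)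
  rcases hKq with h1 | h1
  · rw [hq] at h1
    have : (2 * (m : ℝ)) * (K * Real.exp t) < 2 * m * N ^ m := by linarith
    exact lt_of_mul_lt_mul_left this (by positivity)
  · rw [h1, zero_mul]; exact hNm

open scoped Classical in
theorem card_specNorm_lt (hn : 0 < n) {m : ℕ} (hm : 3 ≤ m) (z : Fin d → ℤ)
    {r : (Fin d → ℤ) → ℝ} (hr : ∀ h, 0 < r h) (B : Finset (Fin d → ℤ)) {t : ℝ} (ht : 0 < t) :
    ((Finset.univ.filter fun f : Fin m → Fin n =>
      ¬ specNorm (matrixPhi r z B f) ^ 2 ≤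
          ENNReal.ofReal (21 * (Real.log m + t)) *
              ∑' h : {h : Fin d → ℤ // h ∉ B}, ENNReal.ofReal (1 / r h) +
            2 * ((m : ℝ≥0∞) / n) * specNorm (matrixPhi r z B (id : Fin n → Fin n)) ^ 2).card : ℝ) <
      Real.exp (-t) * (n : ℝ) ^ m := by
  set S := ∑' h : {h : Fin d → ℤ // h ∉ B}, ENNReal.ofReal (1 / r h) with hS
  set Λ := specNorm (matrixPhi r z B (id : Fin n → Fin n)) ^ 2 with hΛ
  have hm0 : (0 : ℝ) < m := by exact_mod_cast (by omega : 0 < m)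
  have hn0 : (0 : ℝ) < n := by exact_mod_cast hn
  have hL : 0 < 21 * (Real.log m + t) := by
    have := Real.log_nonneg (show (1 : ℝ) ≤ m by exact_mod_cast (by omega : 1 ≤ m))
    linarith
  by_cases hST : S = ∞
  -- If the right-hand side is infinite, there are no violations.
  · have h1 : ENNReal.ofReal (21 * (Real.log m + t)) * S = ∞ := by
      rw [hST, ENNReal.mul_top (ENNReal.ofReal_pos.2 hL).ne']
    simp only [h1, top_add, le_top, not_true_eq_false, Finset.filter_false, Finset.card_empty,
      Nat.cast_zero]
    positivity
  by_cases hΛT : Λ = ∞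
  · have h1 : (2 : ℝ≥0∞) * ((m : ℝ≥0∞) / n) ≠ 0 := by
      simp; omega
    simp only [hΛT, ENNReal.mul_top h1, add_top, le_top, not_true_eq_false, Finset.filter_false,
      Finset.card_empty, Nat.cast_zero]
    positivity
  set a := Λ.toReal with ha
  have ha0 : 0 ≤ a := ENNReal.toReal_nonneg
  have hR : ENNReal.ofReal (21 * (Real.log m + t)) * S + 2 * ((m : ℝ≥0∞) / n) * Λ =
      ENNReal.ofReal (21 * (Real.log m + t) * S.toReal + 2 * (m / n) * a) := by
    rw [ENNReal.ofReal_add (by positivity) (by positivity),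
      ENNReal.ofReal_mul (p := 21 * (Real.log m + t)) hL.le, ENNReal.ofReal_toReal hST, ENNReal.ofReal_mul (p := 2 * (m / n : ℝ)) (by positivity), ha,
      ENNReal.ofReal_toReal hΛT, ENNReal.ofReal_mul two_pos.le, ENNReal.ofReal_div_of_pos hn0]
    simp
  simp only [hR]
  have hb0 : 0 ≤ 21 * (Real.log m + t) * S.toReal + 2 * (m / n) * a := by positivity
  set bad := Finset.univ.filter fun f : Fin m → Fin n => ¬ specNorm (matrixPhi r z B f) ^ 2 ≤
    ENNReal.ofReal (21 * (Real.log m + t) * S.toReal + 2 * (m / n) * a) with hbad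
  have hwit : ∀ f : Fin m → Fin n, ∃ (F : Finset {h : Fin d → ℤ // h ∉ B})
      (x : {h : Fin d → ℤ // h ∉ B} → ℂ), f ∈ bad →
        (21 * (Real.log m + t) * S.toReal + 2 * (m / n) * a) * ∑ i ∈ F, ‖x i‖ ^ 2 <
          ∑ j, ‖∑ i ∈ F, matrixPhi r z B f j i * x i‖ ^ 2 := by
    intro f
    by_cases hf : f ∈ bad
    · have h1 := (Finset.mem_filter.1 hf).2
      rw [specNorm_sq_le_iff _ hb0] at h1
      push Not at h1
      obtain ⟨F, x, hFx⟩ := h1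
      exact ⟨F, x, fun _ => hFx⟩
    · exact ⟨∅, 0, fun h => absurd h hf⟩
  choose F x hFx using hwit
  -- Finitely many frequencies witness all violations at once.
  set G := bad.biUnion F with hG
  rcases bad.eq_empty_or_nonempty with hempty | ⟨f₀, hf₀⟩
  · simp only [hempty, Finset.card_empty, Nat.cast_zero]
    positivity
  set v : Fin n → G → ℂ := fun k h => star (latticeExp z k h / (√(r h) : ℂ)) with hv
  -- The squared length of the rows cut down to `G`; it is at most the full sum `S`.
  set c := ∑ h ∈ G, 1 / r h with hc
  have hGne : G.Nonempty := by
    by_contra hne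
    have h1 : F f₀ = ∅ := Finset.subset_empty.1
      ((Finset.not_nonempty_iff_eq_empty.1 hne) ▸ Finset.subset_biUnion_of_mem F hf₀)
    have := hFx f₀ hf₀
    simp [h1] at this
  have hc0 : 0 < c := Finset.sum_pos (fun h _ => one_div_pos.2 (hr h)) hGne
  have hcS : c ≤ S.toReal := by
    rw [← ENNReal.ofReal_le_iff_le_toReal hST, hc,
      ENNReal.ofReal_sum_of_nonneg (f := fun h : {h : Fin d → ℤ // h ∉ B} => 1 / r h)
        fun h _ => (one_div_pos.2 (hr h)).le]
    exact ENNReal.sum_le_tsum G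
  have hvc : ∀ k, star (v k) ⬝ᵥ v k = (c : ℂ) := by
    intro k
    rw [star_dotProduct_self_eq, hc, ← Finset.sum_coe_sort G]
    refine congrArg _ (Finset.sum_congr rfl fun h _ => ?_)
    rw [hv, norm_star, norm_div, norm_latticeExp, Complex.norm_real, Real.norm_of_nonneg
      (Real.sqrt_nonneg _), div_pow, Real.sq_sqrt (hr _).le, one_pow]
  have hvPhi : ∀ {l : ℕ} (f : Fin l → Fin n) (j : Fin l) (y : {h : Fin d → ℤ // h ∉ B} → ℂ),
      star (v (f j)) ⬝ᵥ (fun h : G => y h) = ∑ h ∈ G, matrixPhi r z B f j h * y h := by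
    intro l f j y
    rw [← Finset.sum_coe_sort]
    simp [hv, dotProduct, matrixPhi]
  have hbd : (a • 1 - outerSum v).PosSemidef := by
    rw [posSemidef_smul_one_sub_outerSum_iff]
    intro y
    have h1 : Λ ≤ ENNReal.ofReal a := by rw [ha, ENNReal.ofReal_toReal hΛT]
    set y' : {h : Fin d → ℤ // h ∉ B} → ℂ := fun h => if hh : h ∈ G then y ⟨h, hh⟩ else 0 with hy'
    have h2 := (specNorm_sq_le_iff _ ha0).1 h1 G y'
    have hyy : (fun h : G => y' h) = y := by funext h; simp [hy']
    simp only [← hvPhi, hyy, id] at h2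
    refine h2.trans_eq ?_
    rw [← Finset.sum_coe_sort, ← hyy]
  -- The constants are generous: the exponent `s = 1 / c` need not be optimized.
  have hcard := card_not_le_of_bounded hc0 hvc ha0 hbd (inv_pos.2 hc0)
    (b := 21 * (Real.log m + t) * c + 2 * (m / n) * a) m
  rw [Fintype.card_fin] at hcard
  refine (Nat.cast_le.2 (Finset.card_le_card ?_)).trans_lt
    (lt_exp_neg_mul_of_bounded_tail hn0 ha0 hc0 hm ht (Nat.cast_nonneg _) hcard)
  intro f hf
  refine Finset.mem_filter.2 ⟨Finset.mem_univ _, fun hpsd => ?_⟩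
  rw [posSemidef_smul_one_sub_outerSum_iff] at hpsd
  set y : {h : Fin d → ℤ // h ∉ B} → ℂ := fun h => if h ∈ F f then x f h else 0 with hy
  have hsub : F f ⊆ G := Finset.subset_biUnion_of_mem F hf
  have h1 := hpsd fun h : G => y h
  simp only [hvPhi] at h1
  have h2 : ∀ j, ∑ h ∈ G, matrixPhi r z B f j h * y h =
      ∑ h ∈ F f, matrixPhi r z B f j h * x f h := by
    intro j
    rw [← Finset.sum_subset hsub fun h _ hh => by simp [hy, hh]]
    exact Finset.sum_congr rfl fun h hh => by simp [hy, hh]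
  have h3 : ∑ h : G, ‖y h‖ ^ 2 = ∑ h ∈ F f, ‖x f h‖ ^ 2 := by
    rw [Finset.sum_coe_sort G fun h => ‖y h‖ ^ 2,
      ← Finset.sum_subset hsub fun h _ hh => by simp [hy, hh]]
    exact Finset.sum_congr rfl fun h hh => by simp [hy, hh]
  simp only [h2, h3] at h1
  refine absurd (hFx f hf) (not_lt.2 (h1.trans ?_))
  gcongr

end Lattice

end RankOneLattice

theorem lemma4p3 {d n m : ℕ} (hn : 0 < n) (z : Fin d → ℤ)
    (r : (Fin d → ℤ) → ℝ) (hr : ∀ h, 0 < r h)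
    (B : Finset (Fin d → ℤ)) (hB : B.Nonempty) (hrec : RankOneLattice.Reconstructing n z B)
    (t : ℝ) (ht : 0 < t)
    (hm : 12 * (B.card : ℝ) * (Real.log B.card + t) ≤ m)
    {Ω : Type*} [MeasurableSpace Ω] (P : Measure Ω) [IsProbabilityMeasure P]
    (J : Fin m → Ω → Fin n)
    (hindep : iIndepFun J P) (hunif : ∀ j, HasLaw (J j) (uniformOn Set.univ) P) :
    1 - Real.exp (-t) < P.real {ω | (m : ℝ) / 2 ≤
        RankOneLattice.sigmaMin (RankOneLattice.matrixL z B fun j => J j ω) ^ 2} ∧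
    1 - Real.exp (-t) < P.real {ω |
        RankOneLattice.sigmaMax (RankOneLattice.matrixL z B fun j => J j ω) ^ 2 ≤
          3 * (m : ℝ) / 2} ∧
    (3 ≤ m → 1 - (2 : ℝ) ^ (3 / 4 : ℝ) * Real.exp (-t) < P.real {ω |
        RankOneLattice.specNorm (RankOneLattice.matrixPhi r z B fun j => J j ω) ^ 2 ≤
          ENNReal.ofReal (21 * (Real.log m + t)) *
              ∑' h : {h : Fin d → ℤ // h ∉ B}, ENNReal.ofReal (1 / r h) +
            2 * ((m : ℝ≥0∞) / n) *
              RankOneLattice.specNorm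
                (RankOneLattice.matrixPhi r z B (id : Fin n → Fin n)) ^ 2}) := by
  -- The `convert` steps identify different decidability instances on the sets of bad maps.
  refine ⟨RankOneLattice.one_sub_lt_measureReal_of_card hn hindep hunif
      (Q := fun f => (m : ℝ) / 2 ≤ RankOneLattice.sigmaMin (RankOneLattice.matrixL z B f) ^ 2)
      (by convert RankOneLattice.card_sigmaMin_lt hn z hB hrec ht hm),
    RankOneLattice.one_sub_lt_measureReal_of_card hn hindep hunif
      (Q := fun f => RankOneLattice.sigmaMax (RankOneLattice.matrixL z B f) ^ 2 ≤ 3 * (m : ℝ) / 2)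
      (by convert RankOneLattice.card_lt_sigmaMax hn z hB hrec ht hm), fun hm3 => ?_⟩
  refine lt_of_le_of_lt ?_ (RankOneLattice.one_sub_lt_measureReal_of_card hn hindep hunif
    (Q := fun f => RankOneLattice.specNorm (RankOneLattice.matrixPhi r z B f) ^ 2 ≤
      ENNReal.ofReal (21 * (Real.log m + t)) *
          ∑' h : {h : Fin d → ℤ // h ∉ B}, ENNReal.ofReal (1 / r h) +
        2 * ((m : ℝ≥0∞) / n) *
          RankOneLattice.specNorm (RankOneLattice.matrixPhi r z B (id : Fin n → Fin n)) ^ 2)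
    (by convert RankOneLattice.card_specNorm_lt hn hm3 z hr B ht))
  have h1 : (1 : ℝ) ≤ (2 : ℝ) ^ (3 / 4 : ℝ) := Real.one_le_rpow one_le_two (by norm_num)
  have h2 := le_mul_of_one_le_left (Real.exp_pos (-t)).le h1
  exact sub_le_sub_left h2 1
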